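/- Let $K$ be an algebraically closed field, let $c,d\ge 2$ be integers, and let $R=K[x_0,\dots,x_c,y_0,\dots,y_d]$ be the polynomial ring in $c+d+2$ indeterminates. Let $I_{c,d}\subset R$ be the ideal generated by the $2$-minors of the matrix $$\left(\begin{array}{cccc|cccc} x_0&x_1&\cdots&x_{c-1}&y_0&y_1&\cdots&y_{d-1}\\ x_1&x_2&\cdots&x_c&y_1&y_2&\cdots&y_d\end{array}\right).$$ Put $$F_i=\sum_{k=0}^i(-1)^k\binom ik x_{i+1}^{i-k}x_kx_i^k\quad(1\le i\le c-1),\qquad F_c=\sum_{k=0}^c(-1)^k\binom ck y_1^{c-k}x_ky_0^k,$$ $$G_i=\sum_{k=0}^i(-1)^k\binom ik y_{i+1}^{i-k}y_ky_i^k\quad(1\le i\le d-1).$$ Then $$I_{c,d}=\operatorname{Rad}(F_1,\dots,F_{c-1},F_c,G_1,\dots,G_{d-1},x_0y_d-x_1y_{d-1}).$$ These are $c+d$ polynomials and $I_{c,d}$ has height $c+d-1$; in particular, $I_{c,d}$ is an almost set-theoretic complete intersection on these polynomials, that is, they generate $I_{c,d}$ up to radical and their number is at most $\operatorname{height}(I_{c,d})+1$.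 -/

import Mathlib

namespace Scroll

section General

variable {R : Type*} [CommRing R]

/-- The matrix with two catalecticant blocks
`(x_0 x_1 … x_{c-1} | y_0 y_1 … y_{d-1})` over `(x_1 x_2 … x_c | y_1 y_2 … y_d)`;
only `x_0, …, x_c` and `y_0, …, y_d` are used. -/
def matrix (c d : ℕ) (x y : ℕ → R) : Matrix (Fin 2) (Fin c ⊕ Fin d) R :=
  Matrix.of fun i => Sum.elim (fun j => x (j.val + i.val)) (fun j => y (j.val + i.val))

/-- The ideal generated by the 2-minors of a two-row matrix. -/
def minorsIdeal {n : Type*} (A : Matrix (Fin 2) n R) : Ideal R :=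
  Ideal.span (Set.range fun p : n × n => (A.submatrix id ![p.1, p.2]).det)

/-- `∑_{k=0}^i (-1)^k (i choose k) x_{i+1}^{i-k} x_k x_i^k`. -/
def formF (x : ℕ → R) (i : ℕ) : R :=
  ∑ k ∈ Finset.range (i + 1),
    (-1) ^ k * (i.choose k : R) * x (i + 1) ^ (i - k) * x k * x i ^ k

/-- `∑_{k=0}^c (-1)^k (c choose k) y_1^{c-k} x_k y_0^k`. -/
def mixedF (c : ℕ) (x y : ℕ → R) : R :=
  ∑ k ∈ Finset.range (c + 1),
    (-1) ^ k * (c.choose k : R) * y 1 ^ (c - k) * x k * y 0 ^ k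

/-- The list `F_1, …, F_{c-1}, F_c, G_1, …, G_{d-1}, x_0 y_d - x_1 y_{d-1}`. -/
def equations (c d : ℕ) (x y : ℕ → R) : List R :=
  (List.range (c - 1)).map (fun i => formF x (i + 1)) ++ [mixedF c x y] ++
    (List.range (d - 1)).map (fun i => formF y (i + 1)) ++ [x 0 * y d - x 1 * y (d - 1)]

/-- `I` is an almost set-theoretic complete intersection on `P_1, …, P_s`: these elements generate
`I` up to radical, and `s ≤ height I + 1`. -/
def IsAlmostSetTheoreticCIOn (I : Ideal R) (P : List R) : Prop :=
  (Ideal.ofList P).radical = I.radical ∧ (P.length : ℕ∞) ≤ I.height + 1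

end General

section Indeterminates

variable (K : Type*) [Field K] (c d : ℕ)

/-- The polynomial ring in the `c + d + 2` indeterminates `x_0, …, x_c, y_0, …, y_d`. -/
abbrev Poly : Type _ := MvPolynomial (Fin (c + 1) ⊕ Fin (d + 1)) K

/-- The indeterminate `x_i`, for `i ≤ c` (the value `0` for `i > c` is never used). -/
noncomputable def xVar (i : ℕ) : Poly K c d :=
  if h : i < c + 1 then MvPolynomial.X (Sum.inl ⟨i, h⟩) else 0

/-- The indeterminate `y_j`, for `j ≤ d` (the value `0` for `j > d` is never used). -/
noncomputable def yVar (j : ℕ) : Poly K c d :=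
  if h : j < d + 1 then MvPolynomial.X (Sum.inr ⟨j, h⟩) else 0

/-- The ideal `I_{c,d}` generated by the 2-minors of the generic matrix. -/
noncomputable def ideal : Ideal (Poly K c d) :=
  minorsIdeal (matrix c d (xVar K c d) (yVar K c d))

/-- The polynomials `F_1, …, F_{c-1}, F_c, G_1, …, G_{d-1}, x_0 y_d - x_1 y_{d-1}` in the
indeterminates. -/
noncomputable def polys : List (Poly K c d) :=
  equations c d (xVar K c d) (yVar K c d)

end Indeterminates

end Scroll

namespace Scroll

/-! At a zero of the listed polynomials over any field, the binomial theorem turns each `F_i`, `G_i`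
into a multiple of a single power. Hence `x` and `y` are each either geometric or zero except in the
last entry. `F_c` and `x_0 y_d - x_1 y_{d-1}` glue the two cases so that the matrix has rank at most
one (`exists_mul_or_eq_zero`). Applied in the residue field of each prime, this puts the minors in
the radical.

Conversely, all the polynomials vanish on `x_i = u t^i`, `y_j = v t^j`. The kernel of this
parametrization is `I_{c,d}` itself (`ideal_eq_ker_toric`, by straightening monomials), so the ideal
is prime, hence radical. Its height is pinned by two prime chains: three strict steps above it, and
`c + d - 1` steps below it. -/

/-- The greedy normal form: `w` units of weight are poured into the slots of types `ts`, slot `t`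
holding at most `cap t`. -/
def greedy {T A : Type*} [CommRing A] (cap : T → ℕ) (z : T → ℕ → A) : List T → ℕ → A
  | [], _ => 1
  | t :: ts, w => z t (min w (cap t)) * greedy cap z ts (w - cap t)

/-! ### Straightening monomials by weight exchange. -/

section Straightening

variable {T A : Type*} [CommRing A] {cap : T → ℕ} {z : T → ℕ → A}

/-- The last unit poured lies in the first slot that `w` units leave unfilled; one exchange moves it
to `s`. The bound on `w` ensures that such a slot exists. -/
theorem greedy_shift
    (hz : ∀ s t i j, i < cap s → j < cap t → z s i * z t (j + 1) = z s (i + 1) * z t j)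
    (ts : List T) (s : T) (i w : ℕ) (hi : i < cap s) (hw : w < (ts.map cap).sum) :
    z s i * greedy cap z ts (w + 1) = z s (i + 1) * greedy cap z ts w := by
  induction ts generalizing w with
  | nil => simp at hw
  | cons t ts ih =>
    simp only [greedy]
    simp only [List.map_cons, List.sum_cons] at hw
    by_cases h : w < cap t
    · rw [min_eq_left (by omega), min_eq_left (by omega), Nat.sub_eq_zero_of_le (by omega),
        Nat.sub_eq_zero_of_le (by omega), ← mul_assoc, hz s t i w hi h, mul_assoc]
    · rw [min_eq_right (by omega), min_eq_right (by omega),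
        show w + 1 - cap t = w - cap t + 1 by omega, mul_left_comm, ih _ (by omega),
        mul_left_comm]

/-- Units move one at a time into `s` until `s` is full or no weight is left. -/
theorem mul_greedy
    (hz : ∀ s t i j, i < cap s → j < cap t → z s i * z t (j + 1) = z s (i + 1) * z t j)
    (ts : List T) (s : T) (i w : ℕ) (hi : i ≤ cap s) (hw : w ≤ (ts.map cap).sum) :
    z s i * greedy cap z ts w = greedy cap z (s :: ts) (i + w) := by
  induction w generalizing i with
  | zero => simp [greedy, min_eq_left hi, Nat.sub_eq_zero_of_le hi]
  | succ w ih =>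
    rcases hi.lt_or_eq with h | h
    · rw [greedy_shift hz ts s i w h (by omega), ih (i + 1) h (by omega)]
      congr 1
      omega
    · simp [greedy, h]

theorem greedy_perm
    (hz : ∀ s t i j, i < cap s → j < cap t → z s i * z t (j + 1) = z s (i + 1) * z t j)
    {ts ts' : List T} (h : ts.Perm ts') (w : ℕ) (hw : w ≤ (ts.map cap).sum) :
    greedy cap z ts w = greedy cap z ts' w := by
  induction h generalizing w with
  | nil => rfl
  | cons t _ ih =>
    simp only [List.map_cons, List.sum_cons] at hw
    simp only [greedy]
    rw [ih _ (by omega)]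
  | swap s t ts =>
    simp only [List.map_cons, List.sum_cons] at hw
    rw [greedy, greedy, mul_left_comm, mul_greedy hz _ _ _ _ (by omega) (by omega),
      mul_greedy hz _ _ _ _ (by omega) (by simp only [List.map_cons, List.sum_cons]; omega)]
    congr 1
    omega
  | trans h₁ _ ih₁ ih₂ =>
    rw [ih₁ w hw, ih₂ w (by rwa [← (h₁.map cap).sum_eq])]

end Straightening

/-! ### The forms on geometric and degenerate sequences. -/

section Forms

variable {R S : Type*} [CommRing R] [CommRing S]

theorem sum_geometric (n : ℕ) (x : ℕ → R) (a b u t : R) (hx : ∀ k ≤ n, x k = u * t ^ k) :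
    ∑ k ∈ Finset.range (n + 1), (-1) ^ k * (n.choose k : R) * a ^ (n - k) * x k * b ^ k =
      u * (a - t * b) ^ n := by
  rw [show a - t * b = -(t * b) + a by ring, add_pow, Finset.mul_sum]
  refine Finset.sum_congr rfl fun k hk => ?_
  rw [hx k (by simpa [Nat.lt_succ_iff] using hk), neg_pow]
  ring

theorem sum_of_forall_lt_eq_zero (n : ℕ) (x : ℕ → R) (a b : R) (hx : ∀ k < n, x k = 0) :
    ∑ k ∈ Finset.range (n + 1), (-1) ^ k * (n.choose k : R) * a ^ (n - k) * x k * b ^ k =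
      (-1) ^ n * x n * b ^ n := by
  rw [Finset.sum_range_succ, Finset.sum_eq_zero]
  · simp
  · intro k hk
    simp [hx k (by simpa using hk)]

theorem map_formF (f : R →+* S) (x : ℕ → R) (i : ℕ) : f (formF x i) = formF (f ∘ x) i := by
  simp [formF]

theorem map_mixedF (f : R →+* S) (c : ℕ) (x y : ℕ → R) :
    f (mixedF c x y) = mixedF c (f ∘ x) (f ∘ y) := by
  simp [mixedF]

theorem formF_eq_zero_of_geometric {x : ℕ → R} {u t : R} {i : ℕ} (hi : i ≠ 0)
    (hx : ∀ k ≤ i + 1, x k = u * t ^ k) : formF x i = 0 := by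
  rw [formF, sum_geometric i x _ _ u t fun k hk => hx k (by omega), hx _ le_rfl, hx i (by omega)]
  rw [show u * t ^ (i + 1) - t * (u * t ^ i) = 0 by ring, zero_pow hi, mul_zero]

theorem mixedF_eq_zero_of_geometric {x y : ℕ → R} {u t : R} {c : ℕ} (hc : c ≠ 0)
    (hx : ∀ k ≤ c, x k = u * t ^ k) (hy : y 1 = t * y 0) : mixedF c x y = 0 := by
  rw [mixedF, sum_geometric c x _ _ u t hx, hy, sub_self, zero_pow hc, mul_zero]

theorem det_minor {n : Type*} (A : Matrix (Fin 2) n R) (p : n × n) :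
    (A.submatrix id ![p.1, p.2]).det = A 0 p.1 * A 1 p.2 - A 0 p.2 * A 1 p.1 := by
  simp [Matrix.det_fin_two]

end Forms

/-! ### Common zeros over a field. -/

section Field

variable {L : Type*} [Field L]

/-- The zero set of `F_1, …, F_{n-1}` is the cone over the rational normal curve. -/
theorem geometric_or_eq_zero (x : ℕ → L) (n : ℕ) (hn : 1 ≤ n)
    (hx : ∀ i, 1 ≤ i → i < n → formF x i = 0) :
    (∃ u t, u ≠ 0 ∧ ∀ k ≤ n, x k = u * t ^ k) ∨ ∀ k < n, x k = 0 := by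
  induction n, hn using Nat.le_induction with
  | base =>
    by_cases h : x 0 = 0
    · exact Or.inr fun k hk => by rwa [Nat.lt_one_iff.mp hk]
    · refine Or.inl ⟨x 0, x 1 / x 0, h, fun k hk => ?_⟩
      interval_cases k
      · simp
      · field_simp
  | succ n hn ih =>
    have h0 := hx n hn (by omega)
    rcases ih fun i h₁ h₂ => hx i h₁ (by omega) with ⟨u, t, hu, h⟩ | h
    · refine Or.inl ⟨u, t, hu, fun k hk => ?_⟩
      rcases hk.lt_or_eq with hk | rfl
      · exact h k (by omega)
      -- Here `F_n = u (x_{n+1} - t x_n)^n`, which forces the next geometric term.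
      rw [formF, sum_geometric n x _ _ u t h, h n le_rfl] at h0
      have := eq_zero_of_pow_eq_zero ((mul_eq_zero.mp h0).resolve_left hu)
      linear_combination this
    · refine Or.inr fun k hk => ?_
      rcases (Nat.lt_succ_iff.mp hk).lt_or_eq with hk | rfl
      · exact h k hk
      -- Only the last summand survives: `F_k = ± x_k^{k+1}`.
      rw [formF, sum_of_forall_lt_eq_zero k x _ _ h] at h0
      have hk : k ≠ 0 := by omega
      simpa [hk] using h0

/-- Either the second row is `t` times the first, or the first row vanishes. -/
theorem exists_mul_or_eq_zero (c d : ℕ) (hc : 1 ≤ c) (hd : 1 ≤ d) (x y : ℕ → L)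
    (hF : ∀ i, 1 ≤ i → i < c → formF x i = 0) (hG : ∀ i, 1 ≤ i → i < d → formF y i = 0)
    (hm : mixedF c x y = 0) (hxy : x 0 * y d = x 1 * y (d - 1)) :
    (∃ t, (∀ i < c, x (i + 1) = t * x i) ∧ ∀ j < d, y (j + 1) = t * y j) ∨
      (∀ i < c, x i = 0) ∧ ∀ j < d, y j = 0 := by
  have step : ∀ {n : ℕ} {w : ℕ → L} {u t : L}, (∀ k ≤ n, w k = u * t ^ k) →
      ∀ i < n, w (i + 1) = t * w i := by
    intro n w u t h i hi
    rw [h (i + 1) hi, h i (by omega)]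
    ring
  rcases geometric_or_eq_zero x c hc hF with ⟨u, t, hu, hx⟩ | hx
  -- `F_c = u (y_1 - t y_0)^c`, so the two ratios agree.
  · rw [mixedF, sum_geometric c x _ _ u t hx] at hm
    have h1 : y 1 = t * y 0 :=
      sub_eq_zero.mp (eq_zero_of_pow_eq_zero ((mul_eq_zero.mp hm).resolve_left hu))
    refine Or.inl ⟨t, step hx, ?_⟩
    rcases geometric_or_eq_zero y d hd hG with ⟨v, t', hv, hy⟩ | hy
    · have ht : t' = t := by
        rw [hy 1 hd, hy 0 (by omega)] at h1
        exact mul_left_cancel₀ hv (by linear_combination h1)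
      exact ht ▸ step hy
    -- The one case that needs the last equation: it reads `u y_d = 0`.
    · rw [hy (d - 1) (by omega), mul_zero, hx 0 (by omega)] at hxy
      have hyd : y d = 0 := by simpa [hu] using hxy
      intro j hj
      rw [hy j hj, mul_zero]
      rcases (Nat.succ_le_of_lt hj).lt_or_eq with h | h
      · exact hy _ h
      · rwa [← h] at hyd
  · rcases geometric_or_eq_zero y d hd hG with ⟨v, t, hv, hy⟩ | hy
    -- Now `F_c = ± x_c y_0^c` with `y_0 = v ≠ 0`.
    · rw [mixedF, sum_of_forall_lt_eq_zero c x _ _ hx] at hm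
      have hxc : x c = 0 := by
        have h0 : y 0 ≠ 0 := by simpa [hy 0] using hv
        simpa [h0] using hm
      refine Or.inl ⟨t, fun i hi => ?_, step hy⟩
      rw [hx i hi, mul_zero]
      rcases (Nat.succ_le_of_lt hi).lt_or_eq with h | h
      · exact hx _ h
      · rwa [← h] at hxc
    · exact Or.inr ⟨hx, hy⟩

theorem det_minor_eq_zero (c d : ℕ) (hc : 1 ≤ c) (hd : 1 ≤ d) (x y : ℕ → L)
    (hF : ∀ i, 1 ≤ i → i < c → formF x i = 0) (hG : ∀ i, 1 ≤ i → i < d → formF y i = 0)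
    (hm : mixedF c x y = 0) (hxy : x 0 * y d = x 1 * y (d - 1))
    (p : (Fin c ⊕ Fin d) × (Fin c ⊕ Fin d)) :
    ((matrix c d x y).submatrix id ![p.1, p.2]).det = 0 := by
  rw [det_minor]
  rcases exists_mul_or_eq_zero c d hc hd x y hF hG hm hxy with ⟨t, hx, hy⟩ | ⟨hx, hy⟩
  · have h : ∀ j, matrix c d x y 1 j = t * matrix c d x y 0 j := by
      rintro (j | j)
      · simpa [matrix] using hx j j.2
      · simpa [matrix] using hy j j.2
    rw [h, h]
    ring
  · have h : ∀ j, matrix c d x y 0 j = 0 := by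
      rintro (j | j)
      · simpa [matrix] using hx j j.2
      · simpa [matrix] using hy j j.2
    rw [h, h]
    ring

end Field

/-! ### From zeros over fields to radicals. -/

section Ring

variable {R : Type*} [CommRing R]

theorem mem_equations {c d : ℕ} {x y : ℕ → R} {r : R} :
    r ∈ equations c d x y ↔ (∃ i, 1 ≤ i ∧ i < c ∧ formF x i = r) ∨ r = mixedF c x y ∨
      (∃ i, 1 ≤ i ∧ i < d ∧ formF y i = r) ∨ r = x 0 * y d - x 1 * y (d - 1) := by
  have h : ∀ (n : ℕ) (w : ℕ → R), r ∈ (List.range (n - 1)).map (fun i => formF w (i + 1)) ↔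
      ∃ i, 1 ≤ i ∧ i < n ∧ formF w i = r := by
    intro n w
    simp only [List.mem_map, List.mem_range]
    constructor
    · rintro ⟨i, hi, rfl⟩
      exact ⟨i + 1, by omega, by omega, rfl⟩
    · rintro ⟨i, h₁, h₂, rfl⟩
      exact ⟨i - 1, by omega, by rw [Nat.sub_add_cancel h₁]⟩
  simp only [equations, List.mem_append, h, List.mem_singleton, or_assoc]

/-- The radical is the intersection of the primes `P` above the equations, and the field case
applies to the fraction field of `R ⧸ P`; no Nullstellensatz enters. -/
theorem minorsIdeal_le_radical (c d : ℕ) (hc : 1 ≤ c) (hd : 1 ≤ d) (x y : ℕ → R) :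
    minorsIdeal (matrix c d x y) ≤ (Ideal.ofList (equations c d x y)).radical := by
  rw [Ideal.radical_eq_sInf]
  refine le_sInf fun P ⟨hJ, hP⟩ => ?_
  rw [minorsIdeal, Ideal.span_le]
  rintro _ ⟨p, rfl⟩
  let f : R →+* FractionRing (R ⧸ P) := (algebraMap (R ⧸ P) _).comp (Ideal.Quotient.mk P)
  have hf : ∀ r, f r = 0 ↔ r ∈ P := fun r => by
    simp only [f, RingHom.comp_apply, FaithfulSMul.algebraMap_eq_zero_iff,
      Ideal.Quotient.eq_zero_iff_mem]
  have hmem : ∀ r ∈ equations c d x y, f r = 0 := fun r hr =>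
    (hf r).mpr (hJ (Ideal.subset_span hr))
  have hmat : (matrix c d x y).map f = matrix c d (f ∘ x) (f ∘ y) := by
    ext i (j | j) <;> simp [matrix]
  refine (hf _).mp ?_
  rw [RingHom.map_det, RingHom.mapMatrix_apply, ← Matrix.submatrix_map, hmat]
  refine det_minor_eq_zero c d hc hd _ _ ?_ ?_ ?_ ?_ p
  · intro i h₁ h₂
    rw [← map_formF]
    exact hmem _ (mem_equations.mpr (Or.inl ⟨i, h₁, h₂, rfl⟩))
  · intro i h₁ h₂
    rw [← map_formF]
    exact hmem _ (mem_equations.mpr (Or.inr (Or.inr (Or.inl ⟨i, h₁, h₂, rfl⟩))))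
  · rw [← map_mixedF]
    exact hmem _ (mem_equations.mpr (Or.inr (Or.inl rfl)))
  · have := hmem _ (mem_equations.mpr (Or.inr (Or.inr (Or.inr rfl))))
    rwa [map_sub, map_mul, map_mul, sub_eq_zero] at this

end Ring

/-! ### The ideal as the kernel of the parametrization. -/

section Toric

open MvPolynomial

variable (K : Type*) [Field K] (c d : ℕ)

/-- The parametrization `x_i = u t^i`, `y_j = v t^j`, where `u, v, t` are the indeterminates
`X 0, X 1, X 2`. -/
noncomputable def param : Fin (c + 1) ⊕ Fin (d + 1) → MvPolynomial (Fin 3) K :=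
  Sum.elim (fun i => X 0 * X 2 ^ i.val) (fun j => X 1 * X 2 ^ j.val)

/-- The homomorphism of the parametrization `x_i = u t^i`, `y_j = v t^j`. -/
noncomputable def toric : Poly K c d →ₐ[K] MvPolynomial (Fin 3) K :=
  aeval (param K c d)

variable {K c d}

theorem xVar_of_le {i : ℕ} (hi : i ≤ c) :
    xVar K c d i = X (Sum.inl ⟨i, Nat.lt_succ_of_le hi⟩) :=
  dif_pos (Nat.lt_succ_of_le hi)

theorem yVar_of_le {j : ℕ} (hj : j ≤ d) :
    yVar K c d j = X (Sum.inr ⟨j, Nat.lt_succ_of_le hj⟩) :=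
  dif_pos (Nat.lt_succ_of_le hj)

theorem toric_xVar {i : ℕ} (hi : i ≤ c) : toric K c d (xVar K c d i) = X 0 * X 2 ^ i := by
  simp [xVar_of_le hi, toric, param]

theorem toric_yVar {j : ℕ} (hj : j ≤ d) : toric K c d (yVar K c d j) = X 1 * X 2 ^ j := by
  simp [yVar_of_le hj, toric, param]

theorem ideal_le_ker_toric : ideal K c d ≤ RingHom.ker (toric K c d) := by
  rw [ideal, minorsIdeal, Ideal.span_le]
  rintro _ ⟨p, rfl⟩
  have h : ∀ j, toric K c d (matrix c d (xVar K c d) (yVar K c d) 1 j) =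
      X 2 * toric K c d (matrix c d (xVar K c d) (yVar K c d) 0 j) := by
    rintro (j | j)
    · have h₁ := toric_xVar (K := K) (d := d) (i := j + 1) j.2
      have h₂ := toric_xVar (K := K) (d := d) (i := j) j.2.le
      simp only [matrix, Matrix.of_apply, Sum.elim_inl, Fin.val_zero, Fin.val_one, add_zero]
      rw [h₁, h₂]
      ring
    · have h₁ := toric_yVar (K := K) (c := c) (j := j + 1) j.2
      have h₂ := toric_yVar (K := K) (c := c) (j := j) j.2.le
      simp only [matrix, Matrix.of_apply, Sum.elim_inr, Fin.val_zero, Fin.val_one, add_zero]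
      rw [h₁, h₂]
      ring
  simp only [SetLike.mem_coe, RingHom.mem_ker, det_minor, map_sub, map_mul, h]
  ring

theorem ofList_polys_le_ker_toric (hc : 1 ≤ c) (hd : 1 ≤ d) :
    Ideal.ofList (polys K c d) ≤ RingHom.ker (toric K c d) := by
  rw [Ideal.ofList, Ideal.span_le]
  intro r hr
  rw [SetLike.mem_coe, RingHom.mem_ker]
  rcases mem_equations.mp hr with ⟨i, h₁, h₂, rfl⟩ | rfl | ⟨i, h₁, h₂, rfl⟩ | rfl
  · rw [← AlgHom.coe_toRingHom, map_formF]
    exact formF_eq_zero_of_geometric (by omega) fun k hk => toric_xVar (by omega)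
  · rw [← AlgHom.coe_toRingHom, map_mixedF]
    refine mixedF_eq_zero_of_geometric (t := X 2) (by omega) (fun k hk => toric_xVar hk) ?_
    simp only [Function.comp_apply, AlgHom.coe_toRingHom]
    rw [toric_yVar hd, toric_yVar (Nat.zero_le d)]
    ring
  · rw [← AlgHom.coe_toRingHom, map_formF]
    exact formF_eq_zero_of_geometric (by omega) fun k hk => toric_yVar (by omega)
  · rw [map_sub, map_mul, map_mul, toric_xVar (Nat.zero_le c), toric_xVar hc, toric_yVar le_rfl,
      toric_yVar (Nat.sub_le d 1)]
    obtain ⟨e, rfl⟩ := Nat.exists_eq_add_of_le' hd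
    simp only [Nat.add_sub_cancel]
    ring

variable (K c d) in
/-- The classes of the indeterminates modulo `I_{c,d}`: those of the `x_i` for `false`, those of the
`y_j` for `true`. -/
noncomputable def varClass (b : Bool) (i : ℕ) : Poly K c d ⧸ ideal K c d :=
  Ideal.Quotient.mk _ (bif b then yVar K c d i else xVar K c d i)

theorem varClass_mul (s t : Bool) (i j : ℕ) (hi : i < bif s then d else c)
    (hj : j < bif t then d else c) :
    varClass K c d s i * varClass K c d t (j + 1) =
      varClass K c d s (i + 1) * varClass K c d t j := by
  have key : ∀ p q : Fin c ⊕ Fin d,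
      matrix c d (xVar K c d) (yVar K c d) 0 p * matrix c d (xVar K c d) (yVar K c d) 1 q -
        matrix c d (xVar K c d) (yVar K c d) 1 p * matrix c d (xVar K c d) (yVar K c d) 0 q ∈
          ideal K c d := by
    intro p q
    have : ((matrix c d (xVar K c d) (yVar K c d)).submatrix id ![p, q]).det ∈ ideal K c d :=
      Ideal.subset_span ⟨(p, q), rfl⟩
    rw [det_minor _ (p, q)] at this
    rwa [mul_comm (matrix c d _ _ 1 p)]
  rw [varClass, varClass, varClass, varClass, ← map_mul, ← map_mul, Ideal.Quotient.eq]
  cases s <;> cases t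
  · exact key (Sum.inl ⟨i, hi⟩) (Sum.inl ⟨j, hj⟩)
  · exact key (Sum.inl ⟨i, hi⟩) (Sum.inr ⟨j, hj⟩)
  · exact key (Sum.inr ⟨i, hi⟩) (Sum.inl ⟨j, hj⟩)
  · exact key (Sum.inr ⟨i, hi⟩) (Sum.inr ⟨j, hj⟩)

/-- The types of the factors of a monomial of degree `n 0` in the `x_i` and `n 1` in the `y_j`. -/
def slots (n : Fin 3 →₀ ℕ) : List Bool :=
  List.replicate (n 0) false ++ List.replicate (n 1) true

variable (K c d) in
/-- The normal form modulo `I_{c,d}` of the monomials that the parametrization sends to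
`u ^ n 0 * v ^ n 1 * t ^ n 2`. -/
noncomputable def normalForm (n : Fin 3 →₀ ℕ) : Poly K c d ⧸ ideal K c d :=
  greedy (fun b => bif b then d else c) (varClass K c d) (slots n) (n 2)

theorem varClass_mul_normalForm (n : Fin 3 →₀ ℕ) (b : Bool) (i : ℕ)
    (hi : i ≤ bif b then d else c)
    (hn : n 2 ≤ ((slots n).map fun b => bif b then d else c).sum) :
    let n' := n + Finsupp.single (bif b then 1 else 0) 1 + Finsupp.single 2 i
    varClass K c d b i * normalForm K c d n = normalForm K c d n' ∧
      n' 2 ≤ ((slots n').map fun b => bif b then d else c).sum := by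
  intro n'
  have hp : (b :: slots n).Perm (slots n') := by
    cases b
    · simp [slots, n', List.replicate_succ]
    · simpa [slots, n', Finsupp.single_apply, List.replicate_succ] using List.perm_middle.symm
  have h2 : n' 2 = i + n 2 := by
    cases b <;> simp [n', add_comm]
  have hb : i + n 2 ≤ ((b :: slots n).map fun b => bif b then d else c).sum := by
    simp only [List.map_cons, List.sum_cons]
    omega
  rw [normalForm, normalForm, mul_greedy varClass_mul _ _ _ _ hi hn,
    greedy_perm varClass_mul hp _ hb, h2]
  exact ⟨rfl, by rwa [← (hp.map _).sum_eq]⟩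

/-- Modulo the ideal, a monomial depends only on its image under `toric`. The capacity bound is
carried along for the induction. -/
theorem exists_normalForm (m : Fin (c + 1) ⊕ Fin (d + 1) →₀ ℕ) (a : K) :
    ∃ n b, toric K c d (monomial m a) = monomial n b ∧
      Ideal.Quotient.mk (ideal K c d) (monomial m a) = b • normalForm K c d n ∧
      n 2 ≤ ((slots n).map fun b => bif b then d else c).sum := by
  refine MvPolynomial.induction_on_monomial
    (motive := fun p => ∃ n b, toric K c d p = monomial n b ∧
      Ideal.Quotient.mk (ideal K c d) p = b • normalForm K c d n ∧
      n 2 ≤ ((slots n).map fun b => bif b then d else c).sum) (fun a => ?_) (fun p s ih => ?_) m a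
  · refine ⟨0, a, ?_, ?_, by simp⟩
    · exact (toric K c d).commutes a
    · simp only [normalForm, slots, Finsupp.coe_zero, Pi.zero_apply, List.replicate_zero,
        List.append_nil, greedy]
      exact Algebra.algebraMap_eq_smul_one (A := Poly K c d ⧸ ideal K c d) a
  · obtain ⟨n, b, h₁, h₂, h₃⟩ := ih
    rcases s with i | j
    · obtain ⟨h₄, h₅⟩ := varClass_mul_normalForm (K := K) n false i (Nat.lt_succ_iff.mp i.2) h₃
      refine ⟨_, b, ?_, ?_, h₅⟩
      -- Writing the coefficient as `b * 1 * 1` splits off the two `Finsupp.single` exponents.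
      · rw [map_mul, h₁, ← mul_one b, ← mul_one (b * 1), ← monomial_mul, ← monomial_mul]
        simp only [toric, aeval_X, param, Sum.elim_inl, X_pow_eq_monomial, mul_one, mul_assoc]
        rfl
      · rw [map_mul, h₂, ← h₄, varClass, cond_false, xVar_of_le (Nat.lt_succ_iff.mp i.2),
          smul_mul_assoc, mul_comm]
    · obtain ⟨h₄, h₅⟩ := varClass_mul_normalForm (K := K) n true j (Nat.lt_succ_iff.mp j.2) h₃
      refine ⟨_, b, ?_, ?_, h₅⟩
      · rw [map_mul, h₁, ← mul_one b, ← mul_one (b * 1), ← monomial_mul, ← monomial_mul]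
        simp only [toric, aeval_X, param, Sum.elim_inr, X_pow_eq_monomial, mul_one, mul_assoc]
        rfl
      · rw [map_mul, h₂, ← h₄, varClass, cond_true, yVar_of_le (Nat.lt_succ_iff.mp j.2),
          smul_mul_assoc, mul_comm]

theorem ideal_eq_ker_toric : ideal K c d = RingHom.ker (toric K c d) := by
  refine le_antisymm ideal_le_ker_toric fun p hp => ?_
  -- A linear map through which the quotient map factors after `toric`; its values at monomials
  -- outside the image are irrelevant.
  let s := (basisMonomials (Fin 3) K).constr K (normalForm K c d)
  have hs : ∀ p, s (toric K c d p) = Ideal.Quotient.mk (ideal K c d) p := by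
    intro p
    induction p using MvPolynomial.induction_on' with
    | monomial m a =>
      obtain ⟨n, b, h₁, h₂, -⟩ := exists_normalForm m a
      have h : s (monomial n 1) = normalForm K c d n := by
        rw [← Module.Basis.constr_basis (basisMonomials (Fin 3) K) K (normalForm K c d) n,
          coe_basisMonomials]
      rw [h₁, h₂, ← h, ← map_smul, smul_monomial, smul_eq_mul, mul_one]
    | add p q hp hq => rw [map_add, map_add, map_add, hp, hq]
  rw [← Ideal.Quotient.eq_zero_iff_mem, ← hs, (RingHom.mem_ker).mp hp, map_zero]

instance isPrime_ideal : (ideal K c d).IsPrime :=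
  ideal_eq_ker_toric (K := K) (c := c) (d := d) ▸ RingHom.ker_isPrime _

theorem ideal_eq_radical (hc : 1 ≤ c) (hd : 1 ≤ d) :
    ideal K c d = (Ideal.ofList (polys K c d)).radical := by
  refine le_antisymm (minorsIdeal_le_radical c d hc hd _ _) ?_
  rw [← (isPrime_ideal (K := K) (c := c) (d := d)).radical]
  exact Ideal.radical_mono (ideal_eq_ker_toric (K := K) ▸ ofList_polys_le_ker_toric hc hd)

end Toric

/-! ### Height from two chains of primes. -/

section Height

open MvPolynomial

variable {K : Type*} [Field K] {c d : ℕ}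

theorem height_add_one_le_of_mem_of_notMem {R : Type*} [CommRing R] {P Q : Ideal R} (_ : P.IsPrime)
    (_ : Q.IsPrime) (h : P ≤ Q) {r : R} (hQ : r ∈ Q) (hP : r ∉ P) : P.height + 1 ≤ Q.height :=
  Ideal.height_add_one_le_of_lt_of_isPrime (lt_of_le_of_ne h fun e => hP (e ▸ hQ))

theorem height_ideal_le (hc : 1 ≤ c) : (ideal K c d).height + 3 ≤ (c + d + 2 : ℕ) := by
  let θ (i : Fin 3) : MvPolynomial (Fin 3) K →ₐ[K] MvPolynomial (Fin 3) K :=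
    aeval fun j => if j = i then 0 else X j
  -- Kill `v`, then `t`, then `u`: `t` is seen only through `u t` once `v = 0`, so it must go before
  -- `u`.
  let f₁ := (θ 1).comp (toric K c d)
  let f₂ := (θ 2).comp f₁
  let f₃ := (θ 0).comp f₂
  have hx0 := toric_xVar (K := K) (d := d) (Nat.zero_le c)
  have hx1 := toric_xVar (K := K) (d := d) hc
  have hy0 := toric_yVar (K := K) (c := c) (Nat.zero_le d)
  have le_comp : ∀ (f : Poly K c d →ₐ[K] MvPolynomial (Fin 3) K) i,
      RingHom.ker f ≤ RingHom.ker ((θ i).comp f) := by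
    intro f i r hr
    rw [RingHom.mem_ker] at hr ⊢
    rw [AlgHom.comp_apply, hr, map_zero]
  have h₁ : (ideal K c d).height + 1 ≤ (RingHom.ker f₁).height := by
    rw [ideal_eq_ker_toric]
    refine height_add_one_le_of_mem_of_notMem (RingHom.ker_isPrime _)
      (RingHom.ker_isPrime _) (le_comp _ 1) (r := yVar K c d 0) ?_ ?_
    · simp [RingHom.mem_ker, f₁, hy0, θ]
    · simp [RingHom.mem_ker, hy0]
  have h₂ : (RingHom.ker f₁).height + 1 ≤ (RingHom.ker f₂).height := by
    refine height_add_one_le_of_mem_of_notMem (RingHom.ker_isPrime _)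
      (RingHom.ker_isPrime _) (le_comp _ 2) (r := xVar K c d 1) ?_ ?_
    · simp [RingHom.mem_ker, f₂, f₁, hx1, θ]
    · simp [RingHom.mem_ker, f₁, hx1, θ]
  have h₃ : (RingHom.ker f₂).height + 1 ≤ (RingHom.ker f₃).height := by
    refine height_add_one_le_of_mem_of_notMem (RingHom.ker_isPrime _)
      (RingHom.ker_isPrime _) (le_comp _ 0) (r := xVar K c d 0) ?_ ?_
    · simp [RingHom.mem_ker, f₃, f₂, f₁, hx0, θ]
    · simp [RingHom.mem_ker, f₂, f₁, hx0, θ]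
  have h₄ : (RingHom.ker f₃).height ≤ (c + d + 2 : ℕ) := by
    have h := Ideal.height_le_ringKrullDim_of_ne_top
      (RingHom.ker_isPrime f₃ : (RingHom.ker f₃).IsPrime).ne_top
    rw [MvPolynomial.ringKrullDim_of_isNoetherianRing, ringKrullDim_eq_zero_of_field, zero_add,
      Nat.card_eq_fintype_card, Fintype.card_sum, Fintype.card_fin, Fintype.card_fin,
      show c + 1 + (d + 1) = c + d + 2 by ring] at h
    exact WithBot.coe_le_coe.mp h
  calc (ideal K c d).height + 3 = (ideal K c d).height + 1 + 1 + 1 := by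
        rw [add_assoc, add_assoc]; rfl
    _ ≤ (RingHom.ker f₁).height + 1 + 1 := by gcongr
    _ ≤ (RingHom.ker f₂).height + 1 := by gcongr
    _ ≤ (c + d + 2 : ℕ) := h₃.trans h₄

open Classical in
variable (K c d) in
/-- The parametrization of the indeterminates in `B` only; the others are left free. -/
noncomputable def partialToric (B : Set (Fin (c + 1) ⊕ Fin (d + 1))) :
    Poly K c d →ₐ[K] MvPolynomial (Fin (c + 1) ⊕ Fin (d + 1)) (MvPolynomial (Fin 3) K) :=
  aeval fun s => if s ∈ B then C (param K c d s) else X s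

theorem partialToric_X_of_mem {B : Set (Fin (c + 1) ⊕ Fin (d + 1))} {s} (hs : s ∈ B) :
    partialToric K c d B (X s) = C (param K c d s) := by
  simp [partialToric, hs]

theorem partialToric_X_of_notMem {B : Set (Fin (c + 1) ⊕ Fin (d + 1))} {s} (hs : s ∉ B) :
    partialToric K c d B (X s) = X s := by
  simp [partialToric, hs]

theorem ker_partialToric_mono {A B : Set (Fin (c + 1) ⊕ Fin (d + 1))} (h : A ⊆ B) :
    RingHom.ker (partialToric K c d A) ≤ RingHom.ker (partialToric K c d B) := by
  classical
  let θ : MvPolynomial (Fin (c + 1) ⊕ Fin (d + 1)) (MvPolynomial (Fin 3) K) →ₐ[K]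
      MvPolynomial (Fin (c + 1) ⊕ Fin (d + 1)) (MvPolynomial (Fin 3) K) :=
    (aeval (R := MvPolynomial (Fin 3) K)
      fun s => if s ∈ B then C (param K c d s) else X s).restrictScalars K
  have hθ : partialToric K c d B = θ.comp (partialToric K c d A) := by
    refine MvPolynomial.algHom_ext fun s => ?_
    by_cases hA : s ∈ A
    · simp [partialToric_X_of_mem hA, partialToric_X_of_mem (h hA), θ, algebraMap_eq]
    · simp [partialToric, hA, θ]
  intro r hr
  rw [RingHom.mem_ker] at hr ⊢
  rw [hθ, AlgHom.comp_apply, hr, map_zero]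

theorem ker_partialToric_univ :
    RingHom.ker (partialToric K c d Set.univ) = RingHom.ker (toric K c d) := by
  have h : ∀ p, partialToric K c d Set.univ p = C (toric K c d p) := by
    have : partialToric K c d Set.univ =
        ((Algebra.ofId (MvPolynomial (Fin 3) K) _).restrictScalars K).comp (toric K c d) :=
      MvPolynomial.algHom_ext fun s => by
        simp [partialToric, toric, Algebra.ofId_apply, algebraMap_eq]
    intro p
    rw [this]
    rfl
  ext p
  rw [RingHom.mem_ker, RingHom.mem_ker, h, C_eq_zero]

/-- The relation `x_i x_0^i = x_0 x_1^i` or `y_j x_0^j = y_0 x_1^j` that the indeterminate `s`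
satisfies on the image of the parametrization. -/
theorem exists_relation (hc : 1 ≤ c) (s : Fin (c + 1) ⊕ Fin (d + 1)) :
    ∃ (e : ℕ) (q : Fin (c + 1) ⊕ Fin (d + 1)), (q = Sum.inl 0 ∨ q = Sum.inr 0) ∧
      param K c d s * param K c d (Sum.inl 0) ^ e =
        param K c d q * param K c d (Sum.inl ⟨1, Nat.lt_succ_of_le hc⟩) ^ e := by
  rcases s with i | j
  · exact ⟨i, Sum.inl 0, Or.inl rfl, by simp [param, mul_pow, mul_comm, mul_left_comm]⟩
  · exact ⟨j, Sum.inr 0, Or.inr rfl, by simp [param, mul_pow, mul_comm, mul_left_comm]⟩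

/-- Parametrizing one more indeterminate imposes its relation to `x_0, x_1, y_0`, which fails while
that indeterminate is free. -/
theorem height_ker_partialToric_insert (hc : 1 ≤ c) {B : Set (Fin (c + 1) ⊕ Fin (d + 1))}
    (h0 : Sum.inl 0 ∈ B) (h1 : Sum.inl ⟨1, Nat.lt_succ_of_le hc⟩ ∈ B) (hy : Sum.inr 0 ∈ B)
    {s : Fin (c + 1) ⊕ Fin (d + 1)} (hs : s ∉ B) :
    (RingHom.ker (partialToric K c d B)).height + 1 ≤
      (RingHom.ker (partialToric K c d (insert s B))).height := by
  obtain ⟨e, q, hq, h⟩ := exists_relation (K := K) hc s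
  have hqB : q ∈ B := by rcases hq with rfl | rfl <;> assumption
  refine height_add_one_le_of_mem_of_notMem (RingHom.ker_isPrime _)
    (RingHom.ker_isPrime _) (ker_partialToric_mono (Set.subset_insert s B))
    (r := X s * X (Sum.inl 0) ^ e - X q * X (Sum.inl ⟨1, Nat.lt_succ_of_le hc⟩) ^ e) ?_ ?_
  · rw [RingHom.mem_ker, map_sub, map_mul, map_mul, map_pow, map_pow,
      partialToric_X_of_mem (Set.mem_insert s B), partialToric_X_of_mem (Set.mem_insert_of_mem s h0),
      partialToric_X_of_mem (Set.mem_insert_of_mem s h1),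
      partialToric_X_of_mem (Set.mem_insert_of_mem s hqB), ← map_pow, ← map_pow, ← map_mul,
      ← map_mul, h, sub_self]
  · rw [RingHom.mem_ker, map_sub, map_mul, map_mul, map_pow, map_pow,
      partialToric_X_of_notMem hs, partialToric_X_of_mem h0, partialToric_X_of_mem h1,
      partialToric_X_of_mem hqB]
    intro h'
    -- Setting the free indeterminates to zero leaves a nonzero monomial in `u, v, t`.
    have := congrArg (aeval (R := MvPolynomial (Fin 3) K) fun _ => (0 : MvPolynomial (Fin 3) K)) h'
    rcases hq with rfl | rfl <;> simp [param] at this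

theorem card_le_height_ker_partialToric (hc : 1 ≤ c) (B : Finset (Fin (c + 1) ⊕ Fin (d + 1)))
    (hB : Disjoint B {Sum.inl 0, Sum.inl ⟨1, Nat.lt_succ_of_le hc⟩, Sum.inr 0}) :
    (B.card : ℕ∞) ≤ (RingHom.ker (partialToric K c d
      (B ∪ {Sum.inl 0, Sum.inl ⟨1, Nat.lt_succ_of_le hc⟩, Sum.inr 0}))).height := by
  induction B using Finset.induction_on with
  | empty => simp
  | insert s B hs ih =>
    rw [Finset.disjoint_insert_left] at hB
    have h := height_ker_partialToric_insert (K := K) (s := s) hc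
      (B := B ∪ {Sum.inl 0, Sum.inl ⟨1, Nat.lt_succ_of_le hc⟩, Sum.inr 0})
      (by simp) (by simp) (by simp) (by simpa [hs] using hB.1)
    rw [Finset.card_insert_of_notMem hs, Finset.coe_insert, Set.insert_union]
    push_cast
    exact (add_le_add_left (ih hB.2) 1).trans h

/-- All indeterminates but `x_0, x_1, y_0` are adjoined, giving `c + d + 2 - 3` strict steps. -/
theorem le_height_ideal (hc : 1 ≤ c) : ((c + d - 1 : ℕ) : ℕ∞) ≤ (ideal K c d).height := by
  have h := card_le_height_ker_partialToric (K := K) (d := d) hc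
    {Sum.inl 0, Sum.inl ⟨1, Nat.lt_succ_of_le hc⟩, Sum.inr 0}ᶜ disjoint_compl_left
  have hB : ((({Sum.inl 0, Sum.inl ⟨1, Nat.lt_succ_of_le hc⟩, Sum.inr 0}ᶜ :
      Finset (Fin (c + 1) ⊕ Fin (d + 1))) : Set (Fin (c + 1) ⊕ Fin (d + 1))) ∪
        {Sum.inl 0, Sum.inl ⟨1, Nat.lt_succ_of_le hc⟩, Sum.inr 0}) = Set.univ := by
    rw [Finset.coe_compl]
    simpa using Set.compl_union_self
      ({Sum.inl 0, Sum.inl ⟨1, Nat.lt_succ_of_le hc⟩, Sum.inr 0} : Set (Fin (c + 1) ⊕ Fin (d + 1)))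
  rw [hB, ker_partialToric_univ, ← ideal_eq_ker_toric, Finset.card_compl] at h
  refine le_trans ?_ h
  have h3 := Finset.card_le_three (a := (Sum.inl 0 : Fin (c + 1) ⊕ Fin (d + 1)))
    (b := Sum.inl ⟨1, Nat.lt_succ_of_le hc⟩) (c := Sum.inr 0)
  rw [Fintype.card_sum, Fintype.card_fin, Fintype.card_fin]
  exact_mod_cast (by omega)

theorem height_ideal (hc : 1 ≤ c) : (ideal K c d).height = ((c + d - 1 : ℕ) : ℕ∞) := by
  refine le_antisymm ?_ (le_height_ideal hc)
  have h := height_ideal_le (K := K) (d := d) hc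
  rw [show c + d + 2 = (c + d - 1) + 3 by omega, Nat.cast_add] at h
  exact (ENat.add_le_add_iff_right (by simp)).mp h

end Height

theorem length_equations {R : Type*} [CommRing R] {c d : ℕ} (hc : 1 ≤ c) (hd : 1 ≤ d)
    (x y : ℕ → R) : (equations c d x y).length = c + d := by
  simp only [equations, List.length_append, List.length_map, List.length_range,
    List.length_singleton]
  omega

end Scroll

theorem corollary6 {K : Type*} [Field K] [IsAlgClosed K] (c d : ℕ) (hc : 2 ≤ c) (hd : 2 ≤ d) :
    Scroll.ideal K c d = (Ideal.ofList (Scroll.polys K c d)).radical ∧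
    (Scroll.polys K c d).length = c + d ∧
    (Scroll.ideal K c d).height = ((c + d - 1 : ℕ) : ℕ∞) ∧
    Scroll.IsAlmostSetTheoreticCIOn (Scroll.ideal K c d) (Scroll.polys K c d) := by
  have hc' : 1 ≤ c := by omega
  have hd' : 1 ≤ d := by omega
  have hrad := Scroll.ideal_eq_radical (K := K) hc' hd'
  have hlen : (Scroll.polys K c d).length = c + d := Scroll.length_equations hc' hd' _ _
  have hht := Scroll.height_ideal (K := K) (d := d) hc'
  refine ⟨hrad, hlen, hht, ?_, ?_⟩
  · rw [Scroll.isPrime_ideal.radical, hrad]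
  · rw [hlen, hht]
    exact_mod_cast (by omega)
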